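/- An \emph{MV-algebra} is an algebra $(A;\oplus,{}^*,0,1)$ of type $(2,1,0,0)$ such that $(A;\oplus,0)$ is a commutative monoid and $x^{**}=x$, $x\oplus 1=1$, $x\oplus(x\oplus y^*)^*=y\oplus(y\oplus x^*)^*$ for all $x,y\in A$. An \emph{EMV-algebra} is an algebra $(M;\vee,\wedge,\oplus,0)$ of type $(2,2,2,0)$ such that (i) $(M;\vee,\wedge,0)$ is a distributive lattice with bottom element $0$; (ii) $(M;\oplus,0)$ is a commutative ordered monoid with neutral element $0$ (that is, $x\le y$ implies $x\oplus z\le y\oplus z$); (iii) for each idempotent $a\in M$ (i.e. $a\oplus a=a$) and each $x\in[0,a]$ the element $\lambda_a(x)=\min\{z\in[0,a] : z\oplus x=a\}$ exists, and $([0,a];\oplus,\lambda_a,0,a)$ is an MV-algebra; (iv) for each $x\in M$ there is an idempotent $a\in M$ with $x\le a$. The real interval $[0,1]$ is an EMV-algebra with its usual order and $x\oplus y=\min\{x+y,1\}$. An \emph{EMV-homomorphism} $f:M_1\to M_2$ of EMV-algebras is a map preserving $\vee,\wedge,\oplus,0$ and satisfying $f(\lambda_b(x))=\lambda_{f(b)}(f(x))$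 for each idempotent $b\in M_1$ and each $x\in[0,b]$. A \emph{state-morphism} on $M$ is an EMV-homomorphism $s:M\to[0,1]$ such that $s(x)=1$ for some $x\in M$. The set $\mathcal{SM}(M)$ of state-morphisms on $M$ carries the weak topology, that is, the subspace topology of the product topology on $[0,1]^M$. An \emph{ideal} of $M$ is a non-empty subset $I\subseteq M$ such that $x\le y\in I$ implies $x\in I$, and $x,y\in I$ implies $x\oplus y\in I$. It is \emph{maximal} if $I\neq M$ and $I$ is not properly contained in another proper ideal. The set $\mathrm{MaxI}(M)$ of maximal ideals carries the hull-kernel topology, whose open sets are exactly the sets $O(I)=\{A\in\mathrm{MaxI}(M) : A\not\supseteq I\}$ with $I$ an ideal of $M$. A topological space is a \emph{Baire space} if for each sequence $(U_n)$ of open dense subsets the intersection $\bigcap_n U_n$ is dense. \textbf{Corollary.} For every EMV-algebra $M$, the spaces $\mathcal{SM}(M)$ and $\mathrm{MaxI}(M)$ are Baire spaces. -/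

import Mathlib

universe u

namespace EMV

/-- An MV-algebra structure `(A; ⊕, *, 0, 1)` on the type `A`. -/
structure MVAlgebra (A : Type u) where
  oplus : A → A → A
  star : A → A
  zero : A
  one : A
  oplus_assoc : ∀ x y z, oplus (oplus x y) z = oplus x (oplus y z)
  oplus_comm : ∀ x y, oplus x y = oplus y x
  oplus_zero : ∀ x, oplus x zero = x
  star_star : ∀ x, star (star x) = x
  oplus_one : ∀ x, oplus x one = one
  lukasiewicz : ∀ x y, oplus x (star (oplus x (star y))) = oplus y (star (oplus y (star x)))

/-- An EMV-algebra `(M; ∨, ∧, ⊕, 0)`. The distributive lattice with bottom element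
`0 = ⊥` is given by the instances on `M`; the class adds the operation `⊕`. -/
class EMVAlgebra (M : Type u) [DistribLattice M] [OrderBot M] where
  oplus : M → M → M
  oplus_assoc : ∀ x y z, oplus (oplus x y) z = oplus x (oplus y z)
  oplus_comm : ∀ x y, oplus x y = oplus y x
  oplus_bot : ∀ x, oplus x ⊥ = x
  /-- `(M; ⊕, 0)` is an ordered monoid: `⊕` is monotone (in each argument). -/
  oplus_le_oplus : ∀ x y z, x ≤ y → oplus x z ≤ oplus y z
  /-- For every idempotent `a`, the interval `[0, a]` is an MV-algebra
  `([0, a]; ⊕, λ_a, 0, a)`, where `λ_a(x) = min {z ∈ [0, a] | z ⊕ x = a}`. -/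
  interval_mv : ∀ a : M, oplus a a = a →
    ∃ A : MVAlgebra (Set.Iic a),
      (∀ x y : Set.Iic a, (A.oplus x y : M) = oplus x y) ∧
      (∀ x : Set.Iic a, IsLeast {z : M | z ≤ a ∧ oplus z x = a} (A.star x)) ∧
      (A.zero : M) = ⊥ ∧ (A.one : M) = a
  /-- Every element lies below an idempotent. -/
  exists_idem_ge : ∀ x : M, ∃ a : M, oplus a a = a ∧ x ≤ a

open EMVAlgebra

section

variable {M : Type u} [DistribLattice M] [OrderBot M] [EMVAlgebra M]

/-- Idempotent elements. -/
def IsIdem (a : M) : Prop := oplus a a = a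

theorem exists_lam {a x : M} (ha : IsIdem a) (hx : x ≤ a) :
    ∃ z : M, IsLeast {z : M | z ≤ a ∧ oplus z x = a} z := by
  obtain ⟨A, -, h, -, -⟩ := interval_mv a ha
  exact ⟨A.star ⟨x, hx⟩, h ⟨x, hx⟩⟩

open Classical in
/-- `λ_a(x) = min {z ∈ [0, a] | z ⊕ x = a}`, meaningful for `a` idempotent and `x ≤ a`. -/
noncomputable def lam (a x : M) : M :=
  if h : ∃ z : M, IsLeast {z : M | z ≤ a ∧ oplus z x = a} z then h.choose else ⊥

theorem isLeast_lam {a x : M} (ha : IsIdem a) (hx : x ≤ a) :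
    IsLeast {z : M | z ≤ a ∧ oplus z x = a} (lam a x) := by
  have h := exists_lam ha hx
  rw [lam, dif_pos h]
  exact h.choose_spec

theorem lam_lam {a x : M} (ha : IsIdem a) (hx : x ≤ a) : lam a (lam a x) = x := by
  obtain ⟨A, -, h, -, -⟩ := interval_mv a ha
  have e : ∀ y : Set.Iic a, lam a (y : M) = A.star y := fun y =>
    (isLeast_lam ha y.2).unique (h y)
  have h1 := e ⟨x, hx⟩
  rw [show lam a x = A.star ⟨x, hx⟩ from h1, e, A.star_star]

theorem oplus_mono {x y z w : M} (h1 : x ≤ y) (h2 : z ≤ w) : oplus x z ≤ oplus y w :=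
  (oplus_le_oplus x y z h1).trans <| by
    rw [oplus_comm y z, oplus_comm y w]
    exact oplus_le_oplus z w y h2

theorem le_oplus_left (x y : M) : x ≤ oplus x y := by
  simpa only [oplus_bot] using oplus_mono (le_refl x) (bot_le : ⊥ ≤ y)

theorem le_oplus_right (x y : M) : y ≤ oplus x y := by
  rw [oplus_comm]
  exact le_oplus_left y x

theorem le_oplus_inf {z c x y : M} (h1 : z ≤ oplus c x) (h2 : z ≤ oplus c y) :
    z ≤ oplus c (x ⊓ y) := by
  obtain ⟨e, he, hle⟩ := exists_idem_ge (oplus c (x ⊔ y))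
  have hc : c ≤ e := (le_oplus_left _ _).trans hle
  have hxy : x ⊔ y ≤ e := (le_oplus_right _ _).trans hle
  have hx : x ≤ e := le_sup_left.trans hxy
  have hy : y ≤ e := le_sup_right.trans hxy
  have cl : ∀ {p q : M}, p ≤ e → q ≤ e → oplus p q ≤ e := fun hp hq =>
    (oplus_mono hp hq).trans (le_of_eq he)
  have hz : z ≤ e := h1.trans (cl hc hx)
  have hl := isLeast_lam he hz
  have hd : oplus (lam e z) c ≤ e := cl hl.1.1 hc
  have key : ∀ {w : M}, w ≤ e → z ≤ oplus c w → lam e (oplus (lam e z) c) ≤ w := by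
    intro w hw hzw
    refine (isLeast_lam he hd).2 ⟨hw, le_antisymm (cl hw hd) ?_⟩
    rw [oplus_comm w, oplus_assoc]
    exact (le_of_eq hl.1.2.symm).trans (oplus_mono le_rfl hzw)
  have h3 := le_inf (key hx h1) (key hy h2)
  have hm : x ⊓ y ≤ e := inf_le_left.trans hx
  have h4 : lam e (lam e z) ≤ oplus c (x ⊓ y) := by
    refine (isLeast_lam he hl.1.1).2 ⟨cl hc hm, le_antisymm (cl (cl hc hm) hl.1.1) ?_⟩
    rw [oplus_comm _ (lam e z), ← oplus_assoc, oplus_comm _ (x ⊓ y)]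
    exact (le_of_eq (isLeast_lam he hd).1.2.symm).trans (oplus_mono h3 le_rfl)
  rwa [lam_lam he hz] at h4

/-- Ideals: non-empty lower sets that are closed under `⊕`. -/
structure IsIdeal (I : Set M) : Prop where
  nonempty : I.Nonempty
  mem_of_le : ∀ x y : M, x ≤ y → y ∈ I → x ∈ I
  oplus_mem : ∀ x y : M, x ∈ I → y ∈ I → oplus x y ∈ I

/-- Maximal ideals: proper ideals not properly contained in another proper ideal. -/
structure IsMaximalIdeal (I : Set M) : Prop where
  isIdeal : IsIdeal I
  ne_univ : I ≠ Set.univ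
  maximal : ∀ J : Set M, IsIdeal J → J ≠ Set.univ → I ⊆ J → J = I

theorem IsIdeal.bot_mem {I : Set M} (hI : IsIdeal I) : ⊥ ∈ I := by
  obtain ⟨x, hx⟩ := hI.nonempty
  exact hI.mem_of_le _ _ bot_le hx

/-- The join of two ideals. -/
theorem IsIdeal.sup {I J : Set M} (hI : IsIdeal I) (hJ : IsIdeal J) :
    IsIdeal {z : M | ∃ x ∈ I, ∃ y ∈ J, z ≤ oplus x y} where
  nonempty := ⟨⊥, ⊥, hI.bot_mem, ⊥, hJ.bot_mem, bot_le⟩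
  mem_of_le := by
    rintro x y h ⟨p, hp, q, hq, h'⟩
    exact ⟨p, hp, q, hq, h.trans h'⟩
  oplus_mem := by
    rintro x y ⟨p, hp, q, hq, h⟩ ⟨p', hp', q', hq', h'⟩
    refine ⟨_, hI.oplus_mem _ _ hp hp', _, hJ.oplus_mem _ _ hq hq', ?_⟩
    refine (oplus_mono h h').trans (le_of_eq ?_)
    rw [oplus_assoc, oplus_assoc, ← oplus_assoc q, oplus_comm q, oplus_assoc]

theorem IsIdeal.inter {I J : Set M} (hI : IsIdeal I) (hJ : IsIdeal J) : IsIdeal (I ∩ J) where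
  nonempty := ⟨⊥, hI.bot_mem, hJ.bot_mem⟩
  mem_of_le x y h hy := ⟨hI.mem_of_le x y h hy.1, hJ.mem_of_le x y h hy.2⟩
  oplus_mem x y hx hy := ⟨hI.oplus_mem x y hx.1 hy.1, hJ.oplus_mem x y hx.2 hy.2⟩

theorem IsMaximalIdeal.inter_subset {A I J : Set M} (hA : IsMaximalIdeal A) (hI : IsIdeal I)
    (hJ : IsIdeal J) (h : I ∩ J ⊆ A) : I ⊆ A ∨ J ⊆ A := by
  by_contra hn
  obtain ⟨nI, nJ⟩ := not_or.1 hn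
  have key : ∀ {K : Set M}, IsIdeal K → ¬ K ⊆ A → ∀ z, ∃ x ∈ A, ∃ y ∈ K, z ≤ oplus x y := by
    intro K hK hKA z
    by_contra hz
    have hS := hA.maximal _ (hA.isIdeal.sup hK)
      (fun hu => hz ((Set.ext_iff.1 hu z).2 trivial))
      (fun x hx => ⟨x, hx, ⊥, hK.bot_mem, le_oplus_left _ _⟩)
    refine hKA fun y hy => ?_
    rw [← hS]
    exact ⟨⊥, hA.isIdeal.bot_mem, y, hy, le_oplus_right _ _⟩
  refine hA.ne_univ (Set.eq_univ_of_forall fun z => ?_)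
  obtain ⟨a, ha, i, hi, h1⟩ := key hI nI z
  obtain ⟨b, hb, j, hj, h2⟩ := key hJ nJ z
  have h3 : z ≤ oplus (oplus a b) (i ⊓ j) := le_oplus_inf
    (h1.trans (oplus_mono (le_oplus_left _ _) le_rfl))
    (h2.trans (oplus_mono (le_oplus_right _ _) le_rfl))
  exact hA.isIdeal.mem_of_le _ _ h3 <| hA.isIdeal.oplus_mem _ _
    (hA.isIdeal.oplus_mem _ _ ha hb)
    (h ⟨hI.mem_of_le _ _ inf_le_left hi, hJ.mem_of_le _ _ inf_le_right hj⟩)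

/-- The ideal generated by a set. -/
theorem isIdeal_sInter (S : Set M) : IsIdeal (⋂₀ {K : Set M | IsIdeal K ∧ S ⊆ K}) where
  nonempty := ⟨⊥, fun _ hK => hK.1.bot_mem⟩
  mem_of_le x y h hy K hK := hK.1.mem_of_le x y h (hy K hK)
  oplus_mem x y hx hy K hK := hK.1.oplus_mem x y (hx K hK) (hy K hK)

end

/-- The set `MaxI(M)` of maximal ideals of `M`. -/
structure MaxI (M : Type u) [DistribLattice M] [OrderBot M] [EMVAlgebra M] where
  carrier : Set M
  isMaximalIdeal : IsMaximalIdeal carrier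

/-- The hull-kernel topology: the open sets are exactly the sets
`O(I) = {A ∈ MaxI(M) | A ⊉ I}` for `I` an ideal of `M`. -/
instance MaxI.instTopologicalSpace (M : Type u) [DistribLattice M] [OrderBot M] [EMVAlgebra M] :
    TopologicalSpace (MaxI M) where
  IsOpen U := ∃ I : Set M, IsIdeal I ∧ U = {A : MaxI M | ¬ I ⊆ A.carrier}
  isOpen_univ := by
    refine ⟨Set.univ, ⟨⟨⊥, trivial⟩, fun _ _ _ _ => trivial, fun _ _ _ _ => trivial⟩, ?_⟩
    exact (Set.eq_univ_of_forall fun A h =>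
      A.isMaximalIdeal.ne_univ (Set.univ_subset_iff.1 h)).symm
  isOpen_inter := by
    rintro _ _ ⟨I, hI, rfl⟩ ⟨J, hJ, rfl⟩
    refine ⟨I ∩ J, hI.inter hJ, Set.ext fun A => ⟨fun h h' => ?_, fun h => ⟨fun h' => ?_, fun h' => ?_⟩⟩⟩
    · exact (A.isMaximalIdeal.inter_subset hI hJ h').elim h.1 h.2
    · exact h (Set.inter_subset_left.trans h')
    · exact h (Set.inter_subset_right.trans h')
  isOpen_sUnion := by
    intro s hs
    refine ⟨_, isIdeal_sInter (⋃₀ {I : Set M | IsIdeal I ∧ {A : MaxI M | ¬ I ⊆ A.carrier} ∈ s}),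
      Set.ext fun A => ⟨?_, fun h => ?_⟩⟩
    · rintro ⟨U, hU, hA⟩ h
      obtain ⟨I, hI, rfl⟩ := hs U hU
      exact hA fun x hx => h fun K hK => hK.2 ⟨I, ⟨hI, hU⟩, hx⟩
    · by_contra hn
      refine h fun x hx => hx _ ⟨A.isMaximalIdeal.isIdeal, ?_⟩
      rintro y ⟨I, ⟨hI, hIs⟩, hy⟩
      by_contra hyA
      exact hn ⟨_, hIs, fun hIA => hyA (hIA hy)⟩

/-- Truncated addition `min (x + y) 1` on the real interval `[0, 1]`. -/
noncomputable def truncAdd (x y : unitInterval) : unitInterval :=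
  ⟨min ((x : ℝ) + y) 1, le_min (add_nonneg x.2.1 y.2.1) zero_le_one, min_le_right _ _⟩

theorem coe_truncAdd (x y : unitInterval) : (truncAdd x y : ℝ) = min ((x : ℝ) + y) 1 := rfl

theorem coe_eq_zero_or_one {a : unitInterval} (ha : truncAdd a a = a) :
    (a : ℝ) = 0 ∨ (a : ℝ) = 1 := by
  have h := congrArg Subtype.val ha
  rw [coe_truncAdd] at h
  rcases min_choice ((a : ℝ) + a) 1 with h' | h'
  · left; linarith
  · right; linarith

theorem truncAdd_le {a x y : unitInterval} (ha : truncAdd a a = a) (hx : x ≤ a) (hy : y ≤ a) :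
    truncAdd x y ≤ a := by
  rw [← ha]
  exact min_le_min (add_le_add (show (x : ℝ) ≤ a from hx) (show (y : ℝ) ≤ a from hy)) le_rfl

/-- The map `x ↦ a - x` on `[0, a]`. -/
noncomputable def compl (a : unitInterval) (x : Set.Iic a) : Set.Iic a :=
  ⟨⟨(a : ℝ) - (x : unitInterval), sub_nonneg.2 (show ((x : unitInterval) : ℝ) ≤ a from x.2),
    (sub_le_self _ x.1.2.1).trans a.2.2⟩,
    show (a : ℝ) - (x : unitInterval) ≤ a from sub_le_self _ x.1.2.1⟩

theorem coe_compl (a : unitInterval) (x : Set.Iic a) :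
    ((compl a x : unitInterval) : ℝ) = a - (x : unitInterval) := rfl

theorem truncAdd_assoc (x y z : unitInterval) :
    truncAdd (truncAdd x y) z = truncAdd x (truncAdd y z) := by
  have hx := x.2.1
  have hz := z.2.1
  apply Subtype.ext
  simp only [coe_truncAdd]
  generalize (x : ℝ) = p at *
  generalize (y : ℝ) = q at *
  generalize (z : ℝ) = r at *
  grind

theorem truncAdd_comm (x y : unitInterval) : truncAdd x y = truncAdd y x :=
  Subtype.ext (by simp only [coe_truncAdd, add_comm])

theorem truncAdd_bot (x : unitInterval) : truncAdd x ⊥ = x :=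
  Subtype.ext (by
    rw [coe_truncAdd, show ((⊥ : unitInterval) : ℝ) = 0 from rfl, add_zero]
    exact min_eq_left x.2.2)

theorem truncAdd_compl_compl {a : unitInterval} (ha : (a : ℝ) = 0 ∨ (a : ℝ) = 1) (x y z w : ℝ)
    (hx : 0 ≤ x) (hxa : x ≤ a) (hy : 0 ≤ y) (hya : y ≤ a)
    (hz : z = a - min (x + (a - y)) 1) (hw : w = a - min (y + (a - x)) 1) :
    min (x + z) 1 = min (y + w) 1 := by
  generalize (a : ℝ) = e at *
  rcases ha with rfl | rfl
  · obtain rfl : x = 0 := le_antisymm hxa hx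
    obtain rfl : y = 0 := le_antisymm hya hy
    rw [hz, hw]
  · rcases le_total x y with h | h
    · rw [min_eq_left (by linarith)] at hz
      rw [min_eq_right (by linarith)] at hw
      rw [hz, hw]
      congr 1
      ring
    · rw [min_eq_right (by linarith)] at hz
      rw [min_eq_left (by linarith)] at hw
      rw [hz, hw]
      congr 1
      ring

/-- The MV-algebra on `[0, a]` for an idempotent `a` of the real interval `[0, 1]`. -/
noncomputable def unitIntervalMV (a : unitInterval) (ha : truncAdd a a = a) :
    MVAlgebra (Set.Iic a) where
  oplus x y := ⟨truncAdd x y, truncAdd_le ha x.2 y.2⟩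
  star := compl a
  zero := ⟨⊥, show ⊥ ≤ a from bot_le⟩
  one := ⟨a, le_refl a⟩
  oplus_assoc x y z := Subtype.ext (truncAdd_assoc x y z)
  oplus_comm x y := Subtype.ext (truncAdd_comm x y)
  oplus_zero x := Subtype.ext (truncAdd_bot x)
  star_star x := Subtype.ext (Subtype.ext (by simp only [coe_compl, sub_sub_cancel]))
  oplus_one x := Subtype.ext (le_antisymm (truncAdd_le ha x.2 le_rfl)
    (show (a : ℝ) ≤ min ((x : unitInterval) + (a : ℝ)) 1 from
      le_min (le_add_of_nonneg_left x.1.2.1) a.2.2))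
  lukasiewicz x y := Subtype.ext (Subtype.ext
    (truncAdd_compl_compl (coe_eq_zero_or_one ha) _ _ _ _ x.1.2.1 x.2 y.1.2.1 y.2 rfl rfl))

/-- The EMV-algebra (in fact MV-algebra) of the real interval `[0, 1]`:
the usual lattice order, and `x ⊕ y = min (x + y) 1`. -/
noncomputable instance unitIntervalEMV : EMVAlgebra unitInterval where
  oplus := truncAdd
  oplus_assoc := truncAdd_assoc
  oplus_comm := truncAdd_comm
  oplus_bot := truncAdd_bot
  oplus_le_oplus x y z h := min_le_min (add_le_add (show (x : ℝ) ≤ y from h) le_rfl) le_rfl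
  interval_mv a ha := by
    refine ⟨unitIntervalMV a ha, fun _ _ => rfl, fun x => ⟨⟨(compl a x).2, Subtype.ext ?_⟩, ?_⟩,
      rfl, rfl⟩
    · change min (((a : ℝ) - (x : unitInterval)) + (x : unitInterval)) 1 = a
      rw [sub_add_cancel]
      exact min_eq_left a.2.2
    · rintro z ⟨_, hzx⟩
      have h : min ((z : ℝ) + (x : unitInterval)) 1 = a := congrArg Subtype.val hzx
      change (a : ℝ) - (x : unitInterval) ≤ z
      have := min_le_left ((z : ℝ) + (x : unitInterval)) 1
      linarith
  exists_idem_ge x := by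
    refine ⟨1, Subtype.ext ?_, unitInterval.le_one x⟩
    rw [coe_truncAdd]
    norm_num

/-- EMV-homomorphisms. -/
structure IsEMVHom {M N : Type*} [DistribLattice M] [OrderBot M] [EMVAlgebra M]
    [DistribLattice N] [OrderBot N] [EMVAlgebra N] (f : M → N) : Prop where
  map_sup : ∀ x y, f (x ⊔ y) = f x ⊔ f y
  map_inf : ∀ x y, f (x ⊓ y) = f x ⊓ f y
  map_oplus : ∀ x y, f (oplus x y) = oplus (f x) (f y)
  map_bot : f ⊥ = ⊥
  map_lam : ∀ b x : M, IsIdem b → x ≤ b → f (lam b x) = lam (f b) (f x)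

/-- The set `SM(M)` of state-morphisms on `M`: the EMV-homomorphisms from `M` to `[0, 1]`
that attain the value `1`. -/
def SM (M : Type u) [DistribLattice M] [OrderBot M] [EMVAlgebra M] : Type u :=
  {s : M → unitInterval // IsEMVHom s ∧ ∃ x, s x = 1}

/-- The weak topology: the subspace topology of the product topology on `[0, 1]^M`. -/
instance SM.instTopologicalSpace (M : Type u) [DistribLattice M] [OrderBot M] [EMVAlgebra M] :
    TopologicalSpace (SM M) :=
  TopologicalSpace.induced (fun (s : SM M) (x : M) => s.1 x) inferInstance

end EMV

/-! Both spaces are Hausdorff and locally compact, so the Baire category theorem applies; the two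
are treated separately.

`SM M` sits in the compact cube `[0,1]^M`. The homomorphism axioms are equations between continuous
functions of coordinates (`isEMVHom_iff`), and the zero map is the only homomorphism missing the
value `1`. So `SM M` is a closed set minus a point, hence locally closed.

For `MaxI M`, two points are separated by means of prelinearity (`exists_disjoint_differences`) and
primeness of maximal ideals. Since every element lies below an idempotent, each maximal ideal omits
some idempotent `a`, and the open set of maximal ideals omitting `a` is compact. That compactness
rests on `IsIdeal.exists_isMaximalIdeal`, a Zorn argument in which `a` plays the role of a unit. -/

namespace EMV

open EMVAlgebra

/-! ### Arithmetic of EMV-algebras and existence of maximal ideals -/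

section Arithmetic

variable {M : Type*} [DistribLattice M] [OrderBot M] [EMVAlgebra M]

theorem IsIdem.oplus_le {a x y : M} (ha : IsIdem a) (hx : x ≤ a) (hy : y ≤ a) :
    oplus x y ≤ a :=
  (oplus_mono hx hy).trans (le_of_eq ha)

theorem lam_le {a x : M} (ha : IsIdem a) (hx : x ≤ a) : lam a x ≤ a :=
  (isLeast_lam ha hx).1.1

theorem lam_oplus {a x : M} (ha : IsIdem a) (hx : x ≤ a) : oplus (lam a x) x = a :=
  (isLeast_lam ha hx).1.2

theorem lam_self {a : M} (ha : IsIdem a) : lam a a = ⊥ :=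
  le_bot_iff.1 <| (isLeast_lam ha le_rfl).2 ⟨bot_le, by rw [oplus_comm, oplus_bot]⟩

/-- The defining inequality of `λ_a`. -/
theorem lam_le_of_le {a x z : M} (ha : IsIdem a) (hx : x ≤ a) (hz : z ≤ a)
    (h : a ≤ oplus z x) : lam a x ≤ z :=
  (isLeast_lam ha hx).2 ⟨hz, le_antisymm (ha.oplus_le hz hx) h⟩

/-- The Łukasiewicz identity in the interval `[0, a]`. -/
theorem oplus_lam_oplus_lam {a x y : M} (ha : IsIdem a) (hx : x ≤ a) (hy : y ≤ a) :
    oplus x (lam a (oplus x (lam a y))) = oplus y (lam a (oplus y (lam a x))) := by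
  obtain ⟨A, ho, h, -, -⟩ := interval_mv a ha
  have e : ∀ z : Set.Iic a, (A.star z : M) = lam a (z : M) := fun z =>
    (h z).unique (isLeast_lam ha z.2)
  have := congrArg Subtype.val (A.lukasiewicz ⟨x, hx⟩ ⟨y, hy⟩)
  simpa only [ho, e] using this

/-- Cancellation: an element disjoint from `m` in the additive sense and absorbed by `m` is `0`. -/
theorem eq_bot_of_oplus_le {a m w : M} (ha : IsIdem a) (hm : m ≤ a) (hw : w ≤ lam a m)
    (h : oplus m w ≤ m) : w = ⊥ := by
  have hwa : w ≤ a := hw.trans (lam_le ha hm)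
  have hmw : oplus m w = m := le_antisymm h (le_oplus_left _ _)
  have hlw := lam_le ha hwa
  -- The two sides of this instance of the Łukasiewicz identity reduce to `a` and `lam a w`, so `lam
  -- a w = a`.
  have h1 := oplus_lam_oplus_lam ha hm hlw
  have h2 : oplus (lam a w) (lam a m) = a :=
    le_antisymm (ha.oplus_le hlw (lam_le ha hm))
      ((le_of_eq (lam_oplus ha hwa).symm).trans (oplus_mono le_rfl hw))
  rw [lam_lam ha hwa, hmw, oplus_comm, lam_oplus ha hm, h2, lam_self ha, oplus_bot] at h1
  rw [← lam_lam ha hwa, ← h1, lam_self ha]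

/-- A smaller element has an exact complement, below its complement in `[0, a]`. -/
theorem exists_oplus_eq {a m x : M} (ha : IsIdem a) (hx : x ≤ a) (hmx : m ≤ x) :
    ∃ u, oplus m u = x ∧ u ≤ lam a m := by
  have hm := hmx.trans hx
  have hlx := lam_le ha hx
  -- The witness is the truncated difference of `x` and `m`; the Łukasiewicz identity turns its sum
  -- with `m` into `x ⊕ lam a a = x`.
  refine ⟨lam a (oplus m (lam a x)), ?_, ?_⟩
  · have h : oplus x (lam a m) = a :=
      le_antisymm (ha.oplus_le hx (lam_le ha hm)) <| by
        refine (le_of_eq (lam_oplus ha hm).symm).trans ?_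
        rw [oplus_comm]
        exact oplus_mono hmx le_rfl
    rw [oplus_lam_oplus_lam ha hm hx, h, lam_self ha, oplus_bot]
  · refine lam_le_of_le ha (ha.oplus_le hm hlx) (lam_le ha hm) ?_
    exact (le_of_eq (lam_oplus ha hm).symm).trans (oplus_mono le_rfl (le_oplus_left _ _))

/-- Prelinearity: any two elements have disjoint truncated differences. -/
theorem exists_disjoint_differences (x y : M) :
    ∃ u v : M, x ≤ oplus y u ∧ y ≤ oplus x v ∧ u ⊓ v = ⊥ := by
  obtain ⟨a, ha, hxy⟩ := exists_idem_ge (x ⊔ y)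
  have hx : x ≤ a := le_sup_left.trans hxy
  have hy : y ≤ a := le_sup_right.trans hxy
  obtain ⟨u, hu, hu'⟩ := exists_oplus_eq ha hx (inf_le_left : x ⊓ y ≤ x)
  obtain ⟨v, hv, -⟩ := exists_oplus_eq ha hy (inf_le_right : x ⊓ y ≤ y)
  refine ⟨u, v, ?_, ?_, ?_⟩
  · exact hu.symm.le.trans (oplus_mono inf_le_right le_rfl)
  · exact hv.symm.le.trans (oplus_mono inf_le_left le_rfl)
  -- Adding `u ⊓ v` to `x ⊓ y` stays below both `x` and `y`, so `x ⊓ y` absorbs `u ⊓ v` and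
  -- cancellation applies.
  · refine eq_bot_of_oplus_le ha (inf_le_left.trans hx) (inf_le_left.trans hu') (le_inf ?_ ?_)
    · exact (oplus_mono le_rfl inf_le_left).trans hu.le
    · exact (oplus_mono le_rfl inf_le_right).trans hv.le

/-- Since `⊕` distributes over meets, the right side is the meet of `x ⊕ y`, `x ⊕ z`, `z ⊕ y` and `z
⊕ z`, each of which dominates the left side. -/
theorem oplus_inf_le (x y z : M) : oplus x y ⊓ z ≤ oplus (x ⊓ z) (y ⊓ z) := by
  have h : ∀ c, oplus x y ⊓ z ≤ oplus c y → oplus x y ⊓ z ≤ oplus c (y ⊓ z) := fun c hc =>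
    le_oplus_inf hc (inf_le_right.trans (le_oplus_right _ _))
  have h1 := h x inf_le_left
  have h2 := h z (inf_le_right.trans (le_oplus_left _ _))
  rw [oplus_comm _ (y ⊓ z)] at h1 h2 ⊢
  exact le_oplus_inf h1 h2

/-- An idempotent absorbs everything below it, so cancellation applies with `m = a`. -/
theorem lam_inf_eq_bot {a b : M} (ha : IsIdem a) (hb : IsIdem b) (hab : a ≤ b) :
    lam b a ⊓ a = ⊥ :=
  eq_bot_of_oplus_le hb hab inf_le_left (ha.oplus_le le_rfl inf_le_right)

/-- The ideal of elements whose meet with `u` lies in a given ideal. -/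
theorem IsIdeal.inf_mem {I : Set M} (hI : IsIdeal I) (u : M) : IsIdeal {z | z ⊓ u ∈ I} where
  nonempty := ⟨⊥, by simpa using hI.bot_mem⟩
  mem_of_le _ _ h hy := hI.mem_of_le _ _ (inf_le_inf_right u h) hy
  oplus_mem _ _ hx hy := hI.mem_of_le _ _ (oplus_inf_le _ _ u) (hI.oplus_mem _ _ hx hy)

theorem isIdeal_singleton_bot : IsIdeal ({⊥} : Set M) where
  nonempty := ⟨⊥, rfl⟩
  mem_of_le := by
    rintro x y h rfl
    exact le_bot_iff.1 h
  oplus_mem := by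
    rintro x y rfl rfl
    exact oplus_bot _

/-- Maximal ideals are prime. -/
theorem IsMaximalIdeal.mem_or_mem {A : Set M} (hA : IsMaximalIdeal A) {u v : M}
    (h : u ⊓ v ∈ A) : u ∈ A ∨ v ∈ A := by
  by_contra! hn
  -- This ideal contains both `A` and `u`; by maximality it is everything, forcing `v ∈ A`, or it
  -- equals `A`, forcing `u ∈ A`.
  by_cases hu : {z | z ⊓ v ∈ A} = Set.univ
  · have : v ⊓ v ∈ A := (Set.ext_iff.1 hu v).2 trivial
    exact hn.2 (by rwa [inf_idem] at this)
  · have := hA.maximal _ (hA.isIdeal.inf_mem v) hu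
      fun z hz => hA.isIdeal.mem_of_le _ _ inf_le_left hz
    exact hn.1 (this ▸ (show u ∈ {z | z ⊓ v ∈ A} from h))

/-- An ideal that omits an idempotent `a` lies in a maximal ideal that omits `a`. -/
theorem IsIdeal.exists_isMaximalIdeal {J : Set M} (hJ : IsIdeal J) {a : M} (ha : IsIdem a)
    (haJ : a ∉ J) : ∃ P, IsMaximalIdeal P ∧ J ⊆ P ∧ a ∉ P := by
  obtain ⟨P, hJP, hP⟩ := zorn_subset_nonempty {I : Set M | IsIdeal I ∧ a ∉ I} (by
    intro c hc hch hne
    refine ⟨⋃₀ c, ⟨⟨?_, ?_, ?_⟩, ?_⟩, fun s hs => Set.subset_sUnion_of_mem hs⟩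
    · obtain ⟨s, hs⟩ := hne
      exact ⟨⊥, s, hs, (hc hs).1.bot_mem⟩
    · rintro x y h ⟨s, hs, hy⟩
      exact ⟨s, hs, (hc hs).1.mem_of_le _ _ h hy⟩
    · rintro x y ⟨s, hs, hx⟩ ⟨t, ht, hy⟩
      rcases hch.total hs ht with h | h
      · exact ⟨t, ht, (hc ht).1.oplus_mem _ _ (h hx) hy⟩
      · exact ⟨s, hs, (hc hs).1.oplus_mem _ _ hx (h hy)⟩
    · rintro ⟨s, hs, has⟩
      exact (hc hs).2 has) J ⟨hJ, haJ⟩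
  obtain ⟨hPi, haP⟩ := hP.prop
  refine ⟨P, ⟨hPi, fun h => haP (h ▸ Set.mem_univ a), fun Q hQ hQu hPQ => ?_⟩, hJP, haP⟩
  have hK : IsIdeal {z : M | z ⊓ a ∈ ({⊥} : Set M)} := isIdeal_singleton_bot.inf_mem a
  -- `P` is so far maximal only among ideals omitting `a`. Adjoining all elements disjoint from `a`
  -- does not bring in `a`: from `a ≤ p ⊕ k` with `k ⊓ a = ⊥` follows `a ≤ p`. So `P` already
  -- contains them.
  have hKP : ∀ z : M, z ⊓ a = ⊥ → z ∈ P := by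
    refine fun z hz => hP.le_of_ge ⟨hPi.sup hK, ?_⟩ ?_ ⟨⊥, hPi.bot_mem, z, hz, le_oplus_right _ _⟩
    · rintro ⟨p, hp, k, hk, h⟩
      have h' := le_oplus_inf h (le_oplus_right p a)
      rw [show k ⊓ a = ⊥ from hk, oplus_bot] at h'
      exact haP (hPi.mem_of_le _ _ h' hp)
    · exact fun p hp => ⟨p, hp, ⊥, hK.bot_mem, le_oplus_left _ _⟩
  -- Every `x` lies below an idempotent `b ≥ a`, and `b` is the sum of `a` and `lam b a`, the latter
  -- in `P` because it is disjoint from `a`.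
  have haQ : a ∉ Q := fun haQ => hQu <| Set.eq_univ_of_forall fun x => by
    obtain ⟨b, hb, hxb⟩ := exists_idem_ge (x ⊔ a)
    have hab : a ≤ b := le_sup_right.trans hxb
    refine hQ.mem_of_le x b (le_sup_left.trans hxb) ?_
    rw [← lam_oplus hb hab]
    exact hQ.oplus_mem _ _ (hPQ (hKP _ (lam_inf_eq_bot ha hb hab))) haQ
  exact Set.Subset.antisymm (hP.le_of_ge ⟨hQ, haQ⟩ hPQ) hPQ

end Arithmetic

/-! ### The hull-kernel topology is Hausdorff and locally compact -/

section MaximalIdeals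

variable {M : Type*} [DistribLattice M] [OrderBot M] [EMVAlgebra M]

theorem MaxI.isOpen_notMem (u : M) : IsOpen {A : MaxI M | u ∉ A.carrier} := by
  refine ⟨_, isIdeal_sInter {u}, Set.ext fun A => not_congr ⟨fun h x hx => ?_, fun h => ?_⟩⟩
  · exact hx _ ⟨A.isMaximalIdeal.isIdeal, Set.singleton_subset_iff.2 h⟩
  · exact h fun K hK => hK.2 rfl

instance MaxI.instT2Space : T2Space (MaxI M) := by
  have key : ∀ A B : MaxI M, A ≠ B → ∃ x ∈ A.carrier, x ∉ B.carrier := by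
    intro A B hne
    by_contra! h
    have := A.isMaximalIdeal.maximal _ B.isMaximalIdeal.isIdeal B.isMaximalIdeal.ne_univ h
    cases A
    cases B
    exact hne (by simp_all)
  refine ⟨fun A B hne => ?_⟩
  obtain ⟨x, hxA, hxB⟩ := key A B hne
  obtain ⟨y, hyB, hyA⟩ := key B A hne.symm
  -- `A` omits `v` because `y ≤ x ⊕ v`, and symmetrically `B` omits `u`; by primeness no maximal
  -- ideal omits both.
  obtain ⟨u, v, hu, hv, huv⟩ := exists_disjoint_differences x y
  refine ⟨{C | v ∉ C.carrier}, {C | u ∉ C.carrier}, isOpen_notMem v, isOpen_notMem u, ?_, ?_, ?_⟩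
  · have hA := A.isMaximalIdeal.isIdeal
    exact fun h => hyA (hA.mem_of_le _ _ hv (hA.oplus_mem _ _ hxA h))
  · have hB := B.isMaximalIdeal.isIdeal
    exact fun h => hxB (hB.mem_of_le _ _ hu (hB.oplus_mem _ _ hyB h))
  · refine Set.disjoint_left.2 fun C hCv hCu => ?_
    have hC := C.isMaximalIdeal
    exact (hC.mem_or_mem (huv ▸ hC.isIdeal.bot_mem)).elim hCu hCv

/-- The ideal generated by a cover is the directed union of the ideals `G t` generated by finite
subfamilies. If `a` belongs to it, some `G t` contains `a`, and `t` is a finite subcover. If not, a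
maximal ideal above it that omits `a` would be left uncovered. -/
theorem MaxI.isCompact_notMem {a : M} (ha : IsIdem a) :
    IsCompact {A : MaxI M | a ∉ A.carrier} := by
  classical
  refine isCompact_of_finite_subcover fun {ι} U hU hcov => ?_
  choose I hI hUI using hU
  let G : Finset ι → Set M := fun t => ⋂₀ {K | IsIdeal K ∧ (⋃ i ∈ t, I i) ⊆ K}
  have hG : ∀ t, IsIdeal (G t) := fun t => isIdeal_sInter _
  have hmono : ∀ {s t : Finset ι}, s ⊆ t → G s ⊆ G t := fun h x hx K hK =>
    hx K ⟨hK.1, (Set.biUnion_subset_biUnion_left h).trans hK.2⟩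
  have hJ : IsIdeal (⋃ t, G t) :=
    { nonempty := ⟨⊥, Set.mem_iUnion.2 ⟨∅, (hG ∅).bot_mem⟩⟩
      mem_of_le := fun x y h hy => by
        obtain ⟨t, ht⟩ := Set.mem_iUnion.1 hy
        exact Set.mem_iUnion.2 ⟨t, (hG t).mem_of_le _ _ h ht⟩
      oplus_mem := fun x y hx hy => by
        obtain ⟨s, hs⟩ := Set.mem_iUnion.1 hx
        obtain ⟨t, ht⟩ := Set.mem_iUnion.1 hy
        exact Set.mem_iUnion.2 ⟨s ∪ t, (hG _).oplus_mem _ _ (hmono Finset.subset_union_left hs)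
          (hmono Finset.subset_union_right ht)⟩ }
  by_cases haJ : a ∈ ⋃ t, G t
  · obtain ⟨t, ht⟩ := Set.mem_iUnion.1 haJ
    refine ⟨t, fun A hA => ?_⟩
    by_contra hn
    refine hA (ht _ ⟨A.isMaximalIdeal.isIdeal, Set.iUnion₂_subset fun i hi => ?_⟩)
    by_contra hIA
    refine hn (Set.mem_iUnion₂.2 ⟨i, hi, ?_⟩)
    rw [hUI]
    exact hIA
  · obtain ⟨P, hP, hJP, haP⟩ := hJ.exists_isMaximalIdeal ha haJ
    obtain ⟨i, hi⟩ := Set.mem_iUnion.1 (hcov (show (⟨P, hP⟩ : MaxI M) ∈ _ from haP))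
    rw [hUI] at hi
    refine (hi fun x hx => hJP (Set.mem_iUnion.2 ⟨{i}, fun K hK => hK.2 ?_⟩)).elim
    exact Set.mem_iUnion₂.2 ⟨i, Finset.mem_singleton_self i, hx⟩

instance MaxI.instWeaklyLocallyCompactSpace : WeaklyLocallyCompactSpace (MaxI M) where
  exists_compact_mem_nhds A := by
    obtain ⟨x, hx⟩ := (Set.ne_univ_iff_exists_notMem _).1 A.isMaximalIdeal.ne_univ
    obtain ⟨a, ha, hxa⟩ := exists_idem_ge x
    exact ⟨_, isCompact_notMem ha, (isOpen_notMem a).mem_nhds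
      fun h => hx (A.isMaximalIdeal.isIdeal.mem_of_le _ _ hxa h)⟩

end MaximalIdeals

/-! ### The state-morphism space is locally closed in the cube -/

section StateMorphisms

theorem coe_lam_unitInterval {b x : unitInterval} (hb : IsIdem b) (hx : x ≤ b) :
    ((lam b x : unitInterval) : ℝ) = b - x := by
  obtain ⟨hl, hlx⟩ := (isLeast_lam hb hx).1
  have h1 := congrArg Subtype.val hlx
  change min (((lam b x : unitInterval) : ℝ) + x) 1 = b at h1
  have hc : lam b x ≤ compl b ⟨x, hx⟩ := by
    refine (isLeast_lam hb hx).2 ⟨(compl b ⟨x, hx⟩).2, Subtype.ext ?_⟩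
    change min (((b : ℝ) - x) + x) 1 = b
    rw [sub_add_cancel]
    exact min_eq_left b.2.2
  have hc' : ((lam b x : unitInterval) : ℝ) ≤ b - x := hc
  have := min_le_left (((lam b x : unitInterval) : ℝ) + x) 1
  linarith

variable {M : Type*} [DistribLattice M] [OrderBot M] [EMVAlgebra M]

/-- `lam` is not visibly continuous, so the last axiom is restated through subtraction. This is
legitimate because `f b` is idempotent and `f x ≤ f b`, as `f` preserves `⊕` and joins. -/
theorem isEMVHom_iff {f : M → unitInterval} : IsEMVHom f ↔
    (∀ x y, f (x ⊔ y) = f x ⊔ f y) ∧ (∀ x y, f (x ⊓ y) = f x ⊓ f y) ∧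
    (∀ x y, (f (oplus x y) : ℝ) = min ((f x : ℝ) + f y) 1) ∧ f ⊥ = ⊥ ∧
    ∀ b x : M, IsIdem b → x ≤ b → (f (lam b x) : ℝ) = f b - f x := by
  have aux : (∀ x y, f (x ⊔ y) = f x ⊔ f y) → (∀ x y, f (oplus x y) = oplus (f x) (f y)) →
      ∀ b x : M, IsIdem b → x ≤ b → ((lam (f b) (f x) : unitInterval) : ℝ) = f b - f x := by
    intro hs ho b x hb hx
    refine coe_lam_unitInterval (show oplus (f b) (f b) = f b by rw [← ho, hb]) ?_
    rw [← sup_eq_right, ← hs, sup_eq_right.2 hx]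
  constructor
  · rintro ⟨h1, h2, h3, h4, h5⟩
    exact ⟨h1, h2, fun x y => congrArg Subtype.val (h3 x y), h4,
      fun b x hb hx => by rw [h5 b x hb hx, aux h1 h3 b x hb hx]⟩
  · rintro ⟨h1, h2, h3, h4, h5⟩
    have h3' : ∀ x y, f (oplus x y) = oplus (f x) (f y) := fun x y => Subtype.ext (h3 x y)
    exact ⟨h1, h2, h3', h4,
      fun b x hb hx => Subtype.ext (by rw [h5 b x hb hx, aux h1 h3' b x hb hx])⟩

theorem isClosed_isEMVHom : IsClosed {f : M → unitInterval | IsEMVHom f} := by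
  simp only [isEMVHom_iff, Set.ofPred_and, Set.ofPred_forall]
  refine .inter ?_ (.inter ?_ (.inter ?_ (.inter ?_ ?_)))
  · exact isClosed_iInter fun x => isClosed_iInter fun y =>
      isClosed_eq (by fun_prop) (by fun_prop)
  · exact isClosed_iInter fun x => isClosed_iInter fun y =>
      isClosed_eq (by fun_prop) (by fun_prop)
  · exact isClosed_iInter fun x => isClosed_iInter fun y =>
      isClosed_eq (by fun_prop) (by fun_prop)
  · exact isClosed_eq (by fun_prop) (by fun_prop)
  · exact isClosed_iInter fun b => isClosed_iInter fun x => isClosed_iInter fun _ =>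
      isClosed_iInter fun _ => isClosed_eq (by fun_prop) (by fun_prop)

/-- A homomorphism to `[0, 1]` attains the value `1` as soon as it is not zero. -/
theorem IsEMVHom.exists_eq_one_iff {f : M → unitInterval} (hf : IsEMVHom f) :
    (∃ x, f x = 1) ↔ f ≠ fun _ => ⊥ := by
  constructor
  · rintro ⟨x, hx⟩ rfl
    exact zero_ne_one (congrArg Subtype.val hx)
  · intro h
    obtain ⟨x, hx⟩ := Function.ne_iff.1 h
    obtain ⟨a, ha, hxa⟩ := exists_idem_ge x
    refine ⟨a, Subtype.ext ?_⟩
    -- The only idempotents of `[0,1]` are `0` and `1`, and `f a = 0` would force `f x = 0`.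
    have hfa : truncAdd (f a) (f a) = f a := ((hf.map_oplus a a).symm.trans (congrArg f ha))
    refine (coe_eq_zero_or_one hfa).resolve_left fun h0 => hx ?_
    have hle : f x ≤ f a := by rw [← sup_eq_right, ← hf.map_sup, sup_eq_right.2 hxa]
    exact le_bot_iff.1 (hle.trans (le_of_eq (Subtype.ext h0)))

theorem SM.isEmbedding : Topology.IsEmbedding (fun (s : SM M) (x : M) => s.1 x) :=
  ⟨⟨rfl⟩, fun _ _ h => Subtype.ext h⟩

instance SM.instT2Space : T2Space (SM M) := SM.isEmbedding.t2Space

instance SM.instLocallyCompactSpace : LocallyCompactSpace (SM M) := by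
  refine SM.isEmbedding.isInducing.locallyCompactSpace ?_
  have : Set.range (fun (s : SM M) (x : M) => s.1 x) =
      {f : M → unitInterval | IsEMVHom f} ∩ {fun _ => ⊥}ᶜ := by
    ext f
    constructor
    · rintro ⟨s, rfl⟩
      exact ⟨s.2.1, s.2.1.exists_eq_one_iff.1 s.2.2⟩
    · rintro ⟨hf, h⟩
      exact ⟨⟨f, hf, hf.exists_eq_one_iff.2 h⟩, rfl⟩
  rw [this]
  exact isClosed_isEMVHom.isLocallyClosed.inter isClosed_singleton.isOpen_compl.isLocallyClosed

end StateMorphisms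

end EMV

theorem mainTheorem11 (M : Type*) [DistribLattice M] [OrderBot M] [EMV.EMVAlgebra M] :
    BaireSpace (EMV.SM M) ∧ BaireSpace (EMV.MaxI M) :=
  -- Both instances come from the Baire category theorem for locally compact Hausdorff spaces.
  ⟨inferInstance, inferInstance⟩
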